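/- Let $k$ be an algebraically closed field, let $H$ be an affine (i.e. finitely generated and reduced) commutative Hopf $k$-algebra, and let $G=\operatorname{Hom}_{\mathrm{Alg}}(H,k)$ be the corresponding affine algebraic group, with product $(gh)(a)=g(a_{(1)})h(a_{(2)})$ and $\mathcal O(G)=H$. \textbf{Partial comodule algebras.} A commutative right partial $H$-comodule algebra is a commutative unital $k$-algebra $A$ with a linear map $\bar\rho:A\to A\otimes H$ such that $\bar\rho(ab)=\bar\rho(a)\bar\rho(b)$, $(I\otimes\epsilon)\bar\rho(a)=a$ and $(\bar\rho\otimes I)\bar\rho(a)=[(I\otimes\Delta)\bar\rho(a)](\bar\rho(1_A)\otimes 1_H)$ for all $a,b\in A$. A morphism $A\to B$ is a unital algebra morphism $f$ with $\bar\rho_B\circ f=(f\otimes I)\circ\bar\rho_A$. Let $\mathcal C$ be the category of those whose underlying algebra $A$ is affine (finitely generated and reduced; $A=0$ is allowed). \textbf{Algebraic partial actions.} A partial action of $G$ on a set $M$ consists of subsets $M_g\subseteq M$ and bijections $\alpha_g:M_{g^{-1}}\to M_g$ $(g\in G)$ with $M_e=M$, $\alpha_e=\mathrm{Id}$, $\alpha_g(M_{g^{-1}}\cap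 M_h)=M_g\cap M_{gh}$, and $\alpha_g(\alpha_h(x))=\alpha_{gh}(x)$ for $x\in M_{h^{-1}}\cap M_{(gh)^{-1}}$. If $M\subseteq\mathbb A^n$ is an affine algebraic set (the common zeros of finitely many polynomials; possibly empty), the partial action is \emph{algebraic} if for every $g$ both $M_g$ and $M\setminus M_g$ are algebraic sets and $\alpha_g$ is polynomial, and if $G\bullet M=\{(g,x)\in G\times M: x\in M_{g^{-1}}\}$ and its complement in $G\times M$ are algebraic sets and the map $G\bullet M\to M$, $(g,x)\mapsto\alpha_g(x)$, is polynomial. A morphism from $(M,\alpha)$ to $(N,\beta)$ is a polynomial map $u:M\to N$ such that $u^{-1}(N_g)=M_g$ for all $g\in G$ and $u(\alpha_g(x))=\beta_g(u(x))$ for $x\in M_{g^{-1}}$. Let $\mathcal P$ be the category of algebraic partial actions of $G$ on affine algebraic sets. \textbf{Claim.} There is an equivalence of categories $\mathcal P^{\mathrm{op}}\simeq\mathcal C$ (that is, a contravariant equivalence between $\mathcal P$ and $\mathcal C$) given, up to natural isomorphism, by the following two constructions. \begin{enumerate} \item An algebraic partial action on $M$ is sent to the coordinate algebra $A=\mathcal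 O(M)$ with the partial coaction $\bar\rho:\mathcal O(M)\to\mathcal O(M)\otimes H=\mathcal O(M\times G)$, where $\bar\rho(f)(p,g)=f(\alpha_{g^{-1}}(p))$ if $p\in M_g$ and $\bar\rho(f)(p,g)=0$ otherwise (so $\bar\rho(1)$ is the idempotent which is the characteristic function of $\{(p,g): p\in M_g\}$); a morphism $u:M\to N$ is sent to $f\mapsto f\circ u$. \item A partial comodule algebra $A$ is sent to the affine algebraic set $M=\operatorname{Hom}_{\mathrm{Alg}}(A,k)$, whose polynomial functions are those given by the elements of $A$. With $1_g=(I\otimes g)\bar\rho(1_A)$, $A_g=1_gA$ and $\theta_g=(I\otimes g)\bar\rho|_{A_{g^{-1}}}:A_{g^{-1}}\to A_g$, the partial action is $M_g=\{P\in M: P(1_g)=1\}=\operatorname{Hom}_{\mathrm{Alg}}(A_g,k)$ and $\alpha_g(P)=P\circ\theta_{g^{-1}}$ on $A_g$; a morphism $f:A\to B$ is sent to $P\mapsto P\circ f$. \end{enumerate} -/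

import Mathlib

open CategoryTheory TensorProduct

universe u v w

noncomputable section

/-! ### Affine algebraic sets, polynomial maps, coordinate algebras -/

namespace AffSet

variable {k : Type u} [Field k]

/-- A subset of affine space `𝔸ⁿ` is algebraic if it is the set of common zeros of a finite set of
polynomials. -/
def IsAlgebraic {n : ℕ} (M : Set (Fin n → k)) : Prop :=
  ∃ S : Finset (MvPolynomial (Fin n) k), M = {x | ∀ p ∈ S, MvPolynomial.eval x p = 0}

/-- A map from a subset of `𝔸ⁿ` to a subset of `𝔸ᵐ` is polynomial if its coordinates are
restrictions of polynomials. -/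
def IsPolynomialMap {n m : ℕ} {M : Set (Fin n → k)} {N : Set (Fin m → k)} (f : M → N) : Prop :=
  ∃ F : Fin m → MvPolynomial (Fin n) k,
    ∀ (x : M) (j : Fin m), (f x : Fin m → k) j = MvPolynomial.eval (x : Fin n → k) (F j)

/-- The coordinate algebra `𝒪(M) = k[x₁, …, xₙ] / I(M)`. -/
abbrev Coord {n : ℕ} (M : Set (Fin n → k)) : Type u :=
  MvPolynomial (Fin n) k ⧸ (MvPolynomial.vanishingIdeal k M : Ideal (MvPolynomial (Fin n) k))

/-- Evaluation of elements of the coordinate algebra at a point of `M`. -/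
def evalAt {n : ℕ} {M : Set (Fin n → k)} (x : M) : Coord M →ₐ[k] k :=
  Ideal.Quotient.liftₐ _ (MvPolynomial.aeval (x : Fin n → k)) fun _ hp => hp x x.2

end AffSet

/-! ### The algebraic group of a commutative Hopf algebra -/

section Group

variable (k : Type u) [Field k] (H : Type v) [CommRing H] [HopfAlgebra k H]

/-- The group `G = Hom_Alg(H, k)` under convolution `(g * h)(a) = g(a₍₁₎) h(a₍₂₎)`, with unit the
counit and inverse `g ∘ S`. -/
abbrev HopfPoints : Type (max u v) := WithConv (H →ₐ[k] k)

variable {k H}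

/-- Evaluation at `(g, x)` of a polynomial function on `G × 𝔸ⁿ`. The polynomial functions on `G`
are the functions `g ↦ g a` with `a ∈ H`, so those on `G × 𝔸ⁿ` are given by polynomials in `n`
variables with coefficients in `H`. (If `a₁, …, aₘ` generate `H`, then `g ↦ (g a₁, …, g aₘ)`
embeds `G` in `𝔸ᵐ`, and these are the restrictions to `G × 𝔸ⁿ` of the polynomials on
`𝔸ᵐ × 𝔸ⁿ`.) -/
def HopfPoints.evalProd {n : ℕ} (g : HopfPoints k H) (x : Fin n → k)
    (F : MvPolynomial (Fin n) H) : k :=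
  MvPolynomial.eval₂ (g.ofConv : H →+* k) x F

/-- A subset of `G × 𝔸ⁿ` is algebraic if it is the set of common zeros of finitely many polynomial
functions. -/
def IsAlgebraicInProd {n : ℕ} (Z : Set (HopfPoints k H × (Fin n → k))) : Prop :=
  ∃ S : Finset (MvPolynomial (Fin n) H), Z = {z | ∀ F ∈ S, z.1.evalProd z.2 F = 0}

end Group

/-! ### Partial actions of groups on sets -/

/-- A partial action of a group `G` on a set `X`: subsets `X_g` and bijections
`α_g : X_{g⁻¹} → X_g`. -/
structure PartialGroupAction (G : Type v) [Group G] (X : Type u) where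
  /-- the subsets `X_g` -/
  dom : G → Set X
  /-- the bijections `α_g` -/
  act : ∀ g : G, dom g⁻¹ ≃ dom g
  dom_one : dom 1 = Set.univ
  act_one : ∀ x : dom (1 : G)⁻¹, (act 1 x : X) = x
  /-- `α_g (X_{g⁻¹} ∩ X_h) = X_g ∩ X_{gh}` -/
  image_act : ∀ g h : G,
    (fun x : dom g⁻¹ => (act g x : X)) '' {x | (x : X) ∈ dom h} = dom g ∩ dom (g * h)
  /-- `α_g (α_h x) = α_{gh} x` for `x ∈ X_{h⁻¹} ∩ X_{(gh)⁻¹}`; that `α_h x ∈ X_{g⁻¹}` for such `x`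
  is a consequence of `image_act` -/
  act_act : ∀ (g h : G) (x : X) (hx : x ∈ dom h⁻¹) (hx' : x ∈ dom (g * h)⁻¹)
    (hy : (act h ⟨x, hx⟩ : X) ∈ dom g⁻¹),
    (act g ⟨act h ⟨x, hx⟩, hy⟩ : X) = act (g * h) ⟨x, hx'⟩

/-! ### Algebraic partial actions -/

section AlgPartialAction

variable (k : Type u) [Field k] (H : Type v) [CommRing H] [HopfAlgebra k H]

/-- An algebraic partial action of `G = Hom_Alg(H, k)` on an affine algebraic set `M ⊆ 𝔸ⁿ`. -/
structure AlgPartialAction where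
  n : ℕ
  /-- the affine algebraic set `M` -/
  carrier : Set (Fin n → k)
  isAlgebraic : AffSet.IsAlgebraic carrier
  /-- the partial action on the underlying set -/
  action : PartialGroupAction (HopfPoints k H) carrier
  dom_isAlgebraic : ∀ g, AffSet.IsAlgebraic (Subtype.val '' action.dom g)
  compl_dom_isAlgebraic : ∀ g, AffSet.IsAlgebraic (Subtype.val '' (action.dom g)ᶜ)
  /-- each `α_g` is polynomial -/
  act_polynomial : ∀ g, ∃ F : Fin n → MvPolynomial (Fin n) k,
    ∀ (x : action.dom g⁻¹) (j : Fin n),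
      ((action.act g x : carrier) : Fin n → k) j = MvPolynomial.eval x.1.1 (F j)
  /-- the set `G • M` of compatible couples is algebraic -/
  compatible_isAlgebraic : IsAlgebraicInProd
    {z : HopfPoints k H × (Fin n → k) | ∃ x : carrier, x ∈ action.dom z.1⁻¹ ∧ z.2 = x}
  /-- the complement of `G • M` in `G × M` is algebraic -/
  incompatible_isAlgebraic : IsAlgebraicInProd
    {z : HopfPoints k H × (Fin n → k) | ∃ x : carrier, x ∉ action.dom z.1⁻¹ ∧ z.2 = x}
  /-- the map `α : G • M → M`, `(g, x) ↦ α_g x`, is polynomial -/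
  act_polynomial_joint : ∃ F : Fin n → MvPolynomial (Fin n) H,
    ∀ (g : HopfPoints k H) (x : action.dom g⁻¹) (j : Fin n),
      ((action.act g x : carrier) : Fin n → k) j = g.evalProd x.1.1 (F j)

variable {k H}

namespace AlgPartialAction

/-- A morphism of algebraic partial actions: a polynomial map `f : M → N` with
`f⁻¹(N_g) = M_g` for all `g`, and `f (α_g x) = β_g (f x)` for `x ∈ M_{g⁻¹}`. -/
@[ext]
structure Hom (X Y : AlgPartialAction k H) where
  toFun : X.carrier → Y.carrier
  polynomial : AffSet.IsPolynomialMap toFun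
  mem_dom_iff : ∀ g x, toFun x ∈ Y.action.dom g ↔ x ∈ X.action.dom g
  equivariant : ∀ g (x : X.action.dom g⁻¹),
    toFun (X.action.act g x) = Y.action.act g ⟨toFun x, (mem_dom_iff _ _).2 x.2⟩

/-- The category of algebraic partial actions of `G = Hom_Alg(H, k)`. -/
instance : Category (AlgPartialAction k H) where
  Hom := Hom
  id X :=
    { toFun := id
      polynomial := ⟨MvPolynomial.X, fun x j => by simp⟩
      mem_dom_iff := fun _ _ => Iff.rfl
      equivariant := fun _ _ => rfl }
  comp {X Y Z} f f' :=
    { toFun := f'.toFun ∘ f.toFun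
      polynomial := by
        obtain ⟨F, hF⟩ := f.polynomial
        obtain ⟨F', hF'⟩ := f'.polynomial
        refine ⟨fun j => MvPolynomial.bind₁ F (F' j), fun x j => ?_⟩
        have hx : (f.toFun x : Fin Y.n → k) =
            fun i => MvPolynomial.eval (x : Fin X.n → k) (F i) := funext (hF x)
        rw [Function.comp_apply, hF', hx]
        simp only [← MvPolynomial.coe_aeval_eq_eval, RingHom.coe_coe, MvPolynomial.aeval_bind₁]
      mem_dom_iff := fun g x => (f'.mem_dom_iff g _).trans (f.mem_dom_iff g x)
      equivariant := fun g x => by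
        rw [Function.comp_apply, f.equivariant, f'.equivariant]
        rfl }

end AlgPartialAction

end AlgPartialAction

/-! ### Partial comodule algebras -/

section ParComodAlg

variable (k : Type u) [Field k] (H : Type v) [CommRing H] [HopfAlgebra k H]

/-- A right partial coaction of `H` on a commutative algebra `A`. Since everything is commutative,
the symmetry axiom `(ρ ⊗ I) ρ(a) = (ρ(1) ⊗ 1) ((I ⊗ Δ) ρ(a))` is the same as `coassoc`. -/
structure PartialCoaction (A : Type w) [CommRing A] [Algebra k A] where
  ρ : A →ₗ[k] A ⊗[k] H
  map_mul : ∀ a b, ρ (a * b) = ρ a * ρ b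
  /-- `(I ⊗ ε) ρ(a) = a` -/
  counit : ∀ a, TensorProduct.rid k A
    (LinearMap.lTensor A (Coalgebra.counit : H →ₗ[k] k) (ρ a)) = a
  /-- `(ρ ⊗ I) ρ(a) = ((I ⊗ Δ) ρ(a)) (ρ(1) ⊗ 1)` -/
  coassoc : ∀ a, LinearMap.rTensor H ρ (ρ a) =
    (TensorProduct.assoc k A H H).symm
      (LinearMap.lTensor A (Coalgebra.comul : H →ₗ[k] H ⊗[k] H) (ρ a)) * (ρ 1 ⊗ₜ[k] (1 : H))

/-- A commutative right partial `H`-comodule algebra whose underlying algebra is affine, that is,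
finitely generated and reduced. -/
structure ParComodAlg where
  A : Type u
  [commRing : CommRing A]
  [algebra : Algebra k A]
  [finiteType : Algebra.FiniteType k A]
  [isReduced : IsReduced A]
  coaction : PartialCoaction k H A

attribute [instance] ParComodAlg.commRing ParComodAlg.algebra
  ParComodAlg.finiteType ParComodAlg.isReduced

variable {k H}

namespace ParComodAlg

/-- A morphism of partial comodule algebras: a (unital) algebra morphism `f : A → B` such that
`ρ_B ∘ f = (f ⊗ I) ∘ ρ_A`. -/
@[ext]
structure Hom (A B : ParComodAlg k H) where
  toAlgHom : A.A →ₐ[k] B.A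
  comm : ∀ a, B.coaction.ρ (toAlgHom a) = LinearMap.rTensor H toAlgHom.toLinearMap (A.coaction.ρ a)

/-- The category of affine commutative right partial `H`-comodule algebras. -/
instance : Category (ParComodAlg k H) where
  Hom := Hom
  id A :=
    { toAlgHom := AlgHom.id k A.A
      comm := fun a => by simp }
  comp f f' :=
    { toAlgHom := f'.toAlgHom.comp f.toAlgHom
      comm := fun a => by
        rw [AlgHom.comp_apply, f'.comm, f.comm, AlgHom.comp_toLinearMap, LinearMap.rTensor_comp,
          LinearMap.comp_apply] }

end ParComodAlg

namespace PartialCoaction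

variable {A : Type w} [CommRing A] [Algebra k A] (c : PartialCoaction k H A)

/-- The map `a ↦ (I ⊗ g) ρ(a) = a⁽⁰⁾ g(a⁽¹⁾)`. Its restriction to the ideal `A_{g⁻¹}` below
is `θ_g`. -/
def theta (g : HopfPoints k H) : A →ₗ[k] A :=
  (TensorProduct.rid k A).toLinearMap ∘ₗ LinearMap.lTensor A g.ofConv.toLinearMap ∘ₗ c.ρ

/-- The element `1_g = 1⁽⁰⁾ g(1⁽¹⁾)`. -/
def unitAt (g : HopfPoints k H) : A := c.theta g 1

/-- The ideal `A_g = 1_g A`. -/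
def idealAt (g : HopfPoints k H) : Ideal A := Ideal.span {c.unitAt g}

end PartialCoaction

end ParComodAlg

/-! ### The two constructions -/

section Constructions

variable {k : Type u} [Field k] {H : Type v} [CommRing H] [HopfAlgebra k H]

/-- An isomorphism `φ : 𝒪(M) ≃ A` carries the coordinate-algebra construction of an algebraic
partial action on `M` to the partial coaction of `A`: as a function on `M × G`, `ρ(f)` is
`f(α_{g⁻¹} p)` at `(p, g)` if `p ∈ M_g`, and `0` otherwise. (For `f = 1` this says that `ρ(1)` is
the idempotent which is the characteristic function of `{(p, g) | p ∈ M_g}`.) -/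
def IsCoordinateCoaction (X : AlgPartialAction k H) (A : ParComodAlg k H)
    (φ : AffSet.Coord X.carrier ≃ₐ[k] A.A) : Prop :=
  ∀ (f : AffSet.Coord X.carrier) (p : X.carrier) (g : HopfPoints k H),
    (∀ hp : p ∈ X.action.dom (g⁻¹)⁻¹,
      AffSet.evalAt p (φ.symm (A.coaction.theta g (φ f))) =
        AffSet.evalAt (X.action.act g⁻¹ ⟨p, hp⟩ : X.carrier) f) ∧
    (p ∉ X.action.dom g → AffSet.evalAt p (φ.symm (A.coaction.theta g (φ f))) = 0)

/-- A bijection `ψ : M ≃ Hom_Alg(A, k)` identifies the algebraic partial action on `M` with the one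
constructed from `ρ(1)` and the `θ_g`. -/
structure IsSpectrumAction (A : ParComodAlg k H) (X : AlgPartialAction k H)
    (ψ : X.carrier ≃ (A.A →ₐ[k] k)) : Prop where
  /-- `ψ` respects the structure of affine algebraic set: the polynomial functions on `M` are the
  functions on `Hom_Alg(A, k)` given by elements of `A` -/
  regular : ∀ f : X.carrier → k,
    (∃ F : MvPolynomial (Fin X.n) k, ∀ x : X.carrier, f x = MvPolynomial.eval x.1 F) ↔
      ∃ a : A.A, ∀ x, f x = ψ x a
  /-- `M_g = Hom_Alg(A_g, k)`, the characters of `A` that are unital on the algebra `A_g = 1_g A` -/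
  mem_dom_iff : ∀ g x, x ∈ X.action.dom g ↔ ψ x (A.coaction.unitAt g) = 1
  /-- `α_g(P) = P ∘ θ_{g⁻¹}` on `A_g` -/
  act_apply : ∀ (g : HopfPoints k H) (x : X.action.dom g⁻¹), ∀ a ∈ A.coaction.idealAt g,
    ψ (X.action.act g x) a = ψ x (A.coaction.theta g⁻¹ a)

end Constructions

end

/-! By the Nullstellensatz, points of an affine algebraic set are characters of its coordinate
algebra, and polynomial maps are algebra morphisms. The extra ingredient is that elements of `𝒪(M) ⊗
H` are determined by their values at pairs `(p, g)` (`pairChar_separates`), so a coaction on `𝒪(M)`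
is the same as its table of values.

Given a partial action, the table is `f(α_{g⁻¹} p)` extended by zero (`value`). It comes from an
element of `𝒪(M) ⊗ H` because `G • M` and its complement are both closed, so the indicator of `G •
M` is regular (`exists_pairChar_eq_indicator`). The coaction axioms are then checked pointwise,
partial coassociativity being the cocycle identity `value_value`. The functor is fully faithful
because the values of `ρ(1)` recover the domains and the other values recover the action.

For essential surjectivity, coassociativity sliced along `g` and `h` reads `θ_g θ_h = θ_{gh} · 1_g`
(`theta_theta`), which makes `P ↦ P ∘ θ_{g⁻¹}` a partial action on characters. Transported to a set
`M` with `𝒪(M) ≃ A`, it is algebraic and gives back the coaction of `A`. The quasi-inverse is chosen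
abstractly; its points are identified with characters through the counit isomorphism. -/

noncomputable section

/-! ### Characters of affine algebras -/

section Characters

variable {k : Type u} [Field k]

/-- Over an algebraically closed field, a proper ideal of a finitely generated algebra is contained
in the kernel of a character. -/
theorem exists_character_of_ne_top [IsAlgClosed k] {R : Type*} [CommRing R] [Algebra k R]
    [Algebra.FiniteType k R] {I : Ideal R} (hI : I ≠ ⊤) :
    ∃ χ : R →ₐ[k] k, ∀ a ∈ I, χ a = 0 := by
  obtain ⟨m, hm, hIm⟩ := I.exists_le_maximal hI
  let _ : Field (R ⧸ m) := Ideal.Quotient.field m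
  have : Module.Finite k (R ⧸ m) := finite_of_finite_type_of_isJacobsonRing k (R ⧸ m)
  let e : k ≃ₐ[k] (R ⧸ m) := AlgEquiv.ofBijective (Algebra.ofId k (R ⧸ m))
    (IsAlgClosed.algebraMap_bijective_of_isIntegral (k := k) (K := R ⧸ m))
  refine ⟨(e.symm : (R ⧸ m) →ₐ[k] k).comp (Ideal.Quotient.mkₐ k m), fun a ha => ?_⟩
  have : Ideal.Quotient.mkₐ k m a = 0 := Ideal.Quotient.eq_zero_iff_mem.2 (hIm ha)
  rw [AlgHom.comp_apply, this, map_zero]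

/-- The characters of an affine algebra separate its elements. -/
theorem eq_zero_of_forall_character [IsAlgClosed k] {R : Type*} [CommRing R] [Algebra k R]
    [Algebra.FiniteType k R] [IsReduced R] {a : R} (ha : ∀ χ : R →ₐ[k] k, χ a = 0) : a = 0 := by
  by_contra hne
  have hnil : ¬ IsNilpotent a := fun h => hne h.eq_zero
  -- Rabinowitsch's trick: a character of the nonzero algebra `R[1/a]` restricts to a character of
  -- `R` that does not kill `a`.
  let L := Localization.Away a
  have : Algebra.FiniteType k L :=
    Algebra.FiniteType.trans (S := R) inferInstance inferInstance
  have : Nontrivial L := by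
    rw [← not_subsingleton_iff_nontrivial,
      IsLocalization.subsingleton_iff (M := Submonoid.powers a)]
    exact hnil
  obtain ⟨χ, -⟩ := exists_character_of_ne_top (k := k) (I := (⊥ : Ideal L)) bot_ne_top
  have hu : IsUnit (χ (algebraMap R L a)) :=
    (IsLocalization.Away.algebraMap_isUnit (S := L) a).map χ
  exact hu.ne_zero (ha (χ.comp (IsScalarTower.toAlgHom k R L)))

end Characters

/-! ### Points of a product -/

section Product

variable {k : Type u} [Field k] {A : Type*} [CommRing A] [Algebra k A]
  {B : Type*} [CommRing B] [Algebra k B]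

/-- The character `P ⊗ Q` of `A ⊗ B`. -/
def pairChar (P : A →ₐ[k] k) (Q : B →ₐ[k] k) : A ⊗[k] B →ₐ[k] k :=
  Algebra.TensorProduct.lift P Q fun _ _ => Commute.all _ _

@[simp]
theorem pairChar_tmul (P : A →ₐ[k] k) (Q : B →ₐ[k] k) (a : A) (b : B) :
    pairChar P Q (a ⊗ₜ b) = P a * Q b := by
  simp [pairChar]

theorem pairChar_eq_rid (P : A →ₐ[k] k) (Q : B →ₐ[k] k) (t : A ⊗[k] B) :
    pairChar P Q t = P (TensorProduct.rid k A (LinearMap.lTensor A Q.toLinearMap t)) := by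
  induction t with
  | zero => simp
  | tmul a b => simp [mul_comm]
  | add x y hx hy => simp only [map_add, hx, hy]

theorem exists_eq_pairChar (χ : A ⊗[k] B →ₐ[k] k) :
    ∃ (P : A →ₐ[k] k) (Q : B →ₐ[k] k), χ = pairChar P Q :=
  ⟨χ.comp Algebra.TensorProduct.includeLeft, χ.comp Algebra.TensorProduct.includeRight, by
    ext <;> simp [← Algebra.TensorProduct.one_def]⟩

/-- If families of characters separate the elements of `A` and of `B`, then their products separate
the elements of `A ⊗ B`. -/
theorem pairChar_separates {ι κ : Type*} (P : ι → A →ₐ[k] k) (Q : κ → B →ₐ[k] k)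
    (hP : ∀ a, (∀ i, P i a = 0) → a = 0) (hQ : ∀ b, (∀ j, Q j b = 0) → b = 0)
    (t : A ⊗[k] B) (ht : ∀ i j, pairChar (P i) (Q j) t = 0) : t = 0 := by
  -- Write `t = ∑ b_m ⊗ t_m`. The slice `∑ Q_j(t_m) b_m` is killed by all `P i`, hence zero, so
  -- every `Q_j(t_m)` vanishes.
  let b := Module.Free.chooseBasis k A
  apply (TensorProduct.equivFinsuppOfBasisLeft b (N := B)).injective
  rw [map_zero]
  ext m
  refine hQ _ fun j => ?_
  have h : TensorProduct.rid k A (LinearMap.lTensor A (Q j).toLinearMap t) = 0 :=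
    hP _ fun i => by rw [← pairChar_eq_rid, ht]
  have key : ∀ t : A ⊗[k] B, Q j (TensorProduct.equivFinsuppOfBasisLeft b t m) =
      b.repr (TensorProduct.rid k A (LinearMap.lTensor A (Q j).toLinearMap t)) m := by
    intro t
    induction t with
    | zero => simp
    | tmul x y => simp [mul_comm]
    | add x y hx hy => simp only [map_add, hx, hy, Finsupp.add_apply]
  rw [key, h]
  simp

theorem pairChar_ext {ι κ : Type*} (P : ι → A →ₐ[k] k) (Q : κ → B →ₐ[k] k)
    (hP : ∀ a, (∀ i, P i a = 0) → a = 0) (hQ : ∀ b, (∀ j, Q j b = 0) → b = 0)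
    {s t : A ⊗[k] B} (h : ∀ i j, pairChar (P i) (Q j) s = pairChar (P i) (Q j) t) : s = t :=
  sub_eq_zero.1 <| pairChar_separates P Q hP hQ _ fun i j => by rw [map_sub, h, sub_self]

/-- Two disjoint zero sets that cover all the characters of `R` are separated by an element with
values `0` and `1`. -/
theorem exists_indicator [IsAlgClosed k] {R : Type*} [CommRing R] [Algebra k R]
    [Algebra.FiniteType k R] (S T : Set R)
    (hST : ∀ χ : R →ₐ[k] k, ¬ ((∀ a ∈ S, χ a = 0) ∧ ∀ a ∈ T, χ a = 0)) :
    ∃ e : R, ∀ χ : R →ₐ[k] k,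
      ((∀ a ∈ S, χ a = 0) → χ e = 1) ∧ ((∀ a ∈ T, χ a = 0) → χ e = 0) := by
  -- Disjoint zero sets give comaximal ideals. In `1 = i + e` with `e` in the ideal of `T`, the
  -- element `e` vanishes where `T` does and equals `1` where `S` does.
  have htop : Ideal.span S ⊔ Ideal.span T = ⊤ := by
    by_contra hne
    obtain ⟨χ, hχ⟩ := exists_character_of_ne_top (k := k) hne
    exact hST χ ⟨fun a ha => hχ a (Ideal.mem_sup_left (Ideal.subset_span ha)),
      fun a ha => hχ a (Ideal.mem_sup_right (Ideal.subset_span ha))⟩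
  obtain ⟨i, hi, e, he, hie⟩ := Submodule.mem_sup.1 ((Ideal.eq_top_iff_one _).1 htop)
  have hker : ∀ (U : Set R) (χ : R →ₐ[k] k), (∀ a ∈ U, χ a = 0) → ∀ a ∈ Ideal.span U, χ a = 0 :=
    fun U χ hU a ha => (Ideal.span_le (I := RingHom.ker χ)).2 hU ha
  refine ⟨e, fun χ => ⟨fun hS => ?_, fun hT => hker T χ hT e he⟩⟩
  rw [← map_one χ, ← hie, map_add, hker S χ hS i hi, zero_add]

end Product

/-! ### Points of the coordinate algebra -/

namespace AffSet

variable {k : Type u} [Field k] {n : ℕ} {M : Set (Fin n → k)}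

@[simp]
theorem evalAt_mk (x : M) (p : MvPolynomial (Fin n) k) :
    evalAt x (Ideal.Quotient.mk _ p) = MvPolynomial.eval (x : Fin n → k) p := by
  rw [← MvPolynomial.coe_aeval_eq_eval]
  rfl

/-- Immediate from dividing by the full vanishing ideal; neither closedness of `M` nor the
Nullstellensatz is involved. -/
theorem eq_zero_of_evalAt {f : Coord M} (h : ∀ x, evalAt x f = 0) : f = 0 := by
  obtain ⟨p, rfl⟩ := Ideal.Quotient.mk_surjective f
  refine Ideal.Quotient.eq_zero_iff_mem.2 fun x hx => ?_
  exact h ⟨x, hx⟩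

theorem coord_ext {f g : Coord M} (h : ∀ x, evalAt x f = evalAt x g) : f = g :=
  sub_eq_zero.1 <| eq_zero_of_evalAt fun x => by rw [map_sub, h, sub_self]

theorem evalAt_injective : Function.Injective (evalAt : M → Coord M →ₐ[k] k) := by
  intro x y h
  ext j
  simpa using DFunLike.congr_fun h (Ideal.Quotient.mk _ (MvPolynomial.X j))

/-- The point has as coordinates the values of `χ` on the coordinate functions. It lies in `M`
because the defining equations of `M` are zero in `Coord M`. -/
theorem exists_evalAt_eq (hM : IsAlgebraic M) (χ : Coord M →ₐ[k] k) : ∃ x : M, evalAt x = χ := by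
  obtain ⟨S, hS⟩ := hM
  have key : ∀ p : MvPolynomial (Fin n) k, MvPolynomial.eval
      (fun j => χ (Ideal.Quotient.mk _ (MvPolynomial.X j))) p = χ (Ideal.Quotient.mk _ p) := by
    intro p
    have : MvPolynomial.aeval (fun j => χ (Ideal.Quotient.mk _ (MvPolynomial.X j))) =
        χ.comp (Ideal.Quotient.mkₐ k _) := by ext j; simp
    rw [← MvPolynomial.coe_aeval_eq_eval]
    exact DFunLike.congr_fun this p
  refine ⟨⟨fun j => χ (Ideal.Quotient.mk _ (MvPolynomial.X j)), ?_⟩, ?_⟩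
  · refine (Set.ext_iff.1 hS _).2 fun p hp => ?_
    rw [key, Ideal.Quotient.eq_zero_iff_mem.2, map_zero]
    intro x hx
    exact (Set.ext_iff.1 hS x).1 hx p hp
  · ext f
    obtain ⟨p, rfl⟩ := Ideal.Quotient.mk_surjective f
    rw [evalAt_mk, key]

/-- The points of an algebraic set are the characters of its coordinate algebra. -/
def pointsEquiv (hM : IsAlgebraic M) : M ≃ (Coord M →ₐ[k] k) :=
  Equiv.ofBijective evalAt ⟨evalAt_injective, exists_evalAt_eq hM⟩

instance : IsReduced (Coord M) where
  eq_zero _ hf := eq_zero_of_evalAt fun x => (hf.map (evalAt x)).eq_zero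

variable (M) in
/-- The coordinate functions on `M`. -/
def coordFun (j : Fin n) : Coord M :=
  Ideal.Quotient.mk _ (MvPolynomial.X j)

theorem evalAt_coordFun (p : M) : (fun j => evalAt p (coordFun M j)) = p.1 := by
  ext j
  simp [coordFun]

theorem evalAt_coordFun_apply (p : M) (j : Fin n) : evalAt p (coordFun M j) = p.1 j :=
  congr_fun (evalAt_coordFun p) j

theorem aeval_coordFun_surjective :
    Function.Surjective (MvPolynomial.aeval (coordFun M) : MvPolynomial (Fin n) k →ₐ[k] Coord M) := by
  have : MvPolynomial.aeval (coordFun M) = Ideal.Quotient.mkₐ k _ := by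
    ext j
    simp [coordFun]
  rw [this]
  exact Ideal.Quotient.mkₐ_surjective k _

/-- The pull-back of functions along a polynomial map. -/
theorem exists_pullback {m : ℕ} {N : Set (Fin m → k)} {f : M → N} (hf : IsPolynomialMap f) :
    ∃ φ : Coord N →ₐ[k] Coord M, ∀ x a, evalAt x (φ a) = evalAt (f x) a := by
  obtain ⟨F, hF⟩ := hf
  have key : ∀ (x : M) (p : MvPolynomial (Fin m) k), evalAt x (MvPolynomial.aeval
      (fun j => (Ideal.Quotient.mk _ (F j) : Coord M)) p) = MvPolynomial.eval (f x : Fin m → k) p := by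
    intro x p
    have : (evalAt x).comp (MvPolynomial.aeval (fun j => (Ideal.Quotient.mk _ (F j) : Coord M))) =
        MvPolynomial.aeval (f x : Fin m → k) := by ext j; simp [hF]
    rw [← MvPolynomial.coe_aeval_eq_eval]
    exact DFunLike.congr_fun this p
  refine ⟨Ideal.Quotient.liftₐ _
    (MvPolynomial.aeval fun j => (Ideal.Quotient.mk _ (F j) : Coord M)) fun p hp =>
      eq_zero_of_evalAt fun x => ?_, fun x a => ?_⟩
  · rw [key, ← MvPolynomial.coe_aeval_eq_eval]
    exact hp _ (f x).2
  · obtain ⟨p, rfl⟩ := Ideal.Quotient.mk_surjective a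
    rw [evalAt_mk]
    exact key x p

/-- An algebra morphism between coordinate algebras is induced by a polynomial map. -/
theorem exists_polynomialMap {m : ℕ} {N : Set (Fin m → k)} (hN : IsAlgebraic N)
    (φ : Coord N →ₐ[k] Coord M) :
    ∃ f : M → N, IsPolynomialMap f ∧ ∀ x a, evalAt x (φ a) = evalAt (f x) a := by
  choose f hf using fun x : M => exists_evalAt_eq hN ((evalAt x).comp φ)
  have hf' : ∀ x a, evalAt x (φ a) = evalAt (f x) a := fun x a => by rw [hf]; rfl
  choose F hF using fun j => Ideal.Quotient.mk_surjective
    (φ (Ideal.Quotient.mk _ (MvPolynomial.X j)))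
  refine ⟨f, ⟨F, fun x j => ?_⟩, hf'⟩
  rw [← evalAt_mk, hF, hf']
  simp

/-- The zeros in `M` of an element of the coordinate algebra form an algebraic set. -/
theorem isAlgebraic_zeros (hM : IsAlgebraic M) (f : Coord M) :
    IsAlgebraic (Subtype.val '' {x : M | evalAt x f = 0}) := by
  classical
  obtain ⟨S, hS⟩ := hM
  obtain ⟨p, rfl⟩ := Ideal.Quotient.mk_surjective f
  refine ⟨insert p S, Set.ext fun x => ?_⟩
  have hx := Set.ext_iff.1 hS x
  simp only [Set.mem_ofPred_eq] at hx
  simp [hx, and_comm]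

/-- Every affine algebra is the coordinate algebra of an algebraic set. -/
theorem exists_coord_equiv [IsAlgClosed k] (A : Type*) [CommRing A] [Algebra k A]
    [Algebra.FiniteType k A] [IsReduced A] :
    ∃ (n : ℕ) (M : Set (Fin n → k)), IsAlgebraic M ∧ Nonempty (Coord M ≃ₐ[k] A) := by
  obtain ⟨n, f, hf⟩ := Algebra.FiniteType.iff_quotient_mvPolynomial''.1
    (inferInstance : Algebra.FiniteType k A)
  obtain ⟨S, hS⟩ := (isNoetherianRing_iff_ideal_fg _).1
    (inferInstance : IsNoetherianRing (MvPolynomial (Fin n) k)) (RingHom.ker f)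
  refine ⟨n, MvPolynomial.zeroLocus k (RingHom.ker f), ⟨S, ?_⟩, ⟨?_⟩⟩
  · rw [← hS]
    exact MvPolynomial.zeroLocus_span _
  -- The Nullstellensatz gives the radical of the kernel, which is the kernel itself since `A` is
  -- reduced.
  · have h : MvPolynomial.vanishingIdeal k (MvPolynomial.zeroLocus k (RingHom.ker f)) =
        RingHom.ker f := by
      rw [MvPolynomial.vanishingIdeal_zeroLocus_eq_radical]
      exact (RingHom.ker_isRadical_iff_reduced_of_surjective hf).2 inferInstance |>.radical
    exact (Ideal.quotientEquivAlgOfEq k h).trans (Ideal.quotientKerAlgEquivOfSurjective hf)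

end AffSet

/-! ### Slices of a tensor product along a character -/

section Slice

variable {k : Type u} [Field k] {A : Type*} [CommRing A] [Algebra k A]
  {B : Type*} [CommRing B] [Algebra k B]

/-- The algebra morphism `I ⊗ Q : A ⊗ B → A`. -/
def sliceHom (A : Type*) [CommRing A] [Algebra k A] (Q : B →ₐ[k] k) : A ⊗[k] B →ₐ[k] A :=
  Algebra.TensorProduct.lift (AlgHom.id k A) ((Algebra.ofId k A).comp Q) fun _ _ => Commute.all _ _

@[simp]
theorem sliceHom_tmul (Q : B →ₐ[k] k) (a : A) (b : B) : sliceHom A Q (a ⊗ₜ b) = Q b • a := by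
  simp [sliceHom, Algebra.ofId_apply, Algebra.smul_def, mul_comm]

/-- Replaces the linear map occurring in `theta` and in the counit axiom by an algebra morphism, so
that multiplicativity becomes available. -/
theorem rid_lTensor_eq_sliceHom (Q : B →ₐ[k] k) (t : A ⊗[k] B) :
    TensorProduct.rid k A (LinearMap.lTensor A Q.toLinearMap t) = sliceHom A Q t := by
  induction t with
  | zero => simp
  | tmul a b => simp
  | add x y hx hy => simp only [map_add, hx, hy]

theorem pairChar_eq_sliceHom (P : A →ₐ[k] k) (Q : B →ₐ[k] k) (t : A ⊗[k] B) :
    pairChar P Q t = P (sliceHom A Q t) := by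
  rw [pairChar_eq_rid, rid_lTensor_eq_sliceHom]

theorem sliceHom_rTensor {C : Type*} [CommRing C] [Algebra k C] (Q : B →ₐ[k] k) (f : A →ₗ[k] C)
    (t : A ⊗[k] B) : sliceHom C Q (LinearMap.rTensor B f t) = f (sliceHom A Q t) := by
  induction t with
  | zero => simp
  | tmul a b => simp
  | add x y hx hy => simp only [map_add, hx, hy]

variable {H : Type v} [CommRing H] [HopfAlgebra k H]

/-- The convolution product in `G` seen from `A ⊗ H`: after `I ⊗ Δ`, `h` evaluates the last factor
and `g` the middle one. -/
theorem sliceHom_sliceHom_comul (g h : HopfPoints k H) (t : A ⊗[k] H) :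
    sliceHom A g.ofConv (sliceHom (A ⊗[k] H) h.ofConv ((TensorProduct.assoc k A H H).symm
      (LinearMap.lTensor A (Coalgebra.comul : H →ₗ[k] H ⊗[k] H) t))) =
      sliceHom A (g * h).ofConv t := by
  induction t with
  | zero => simp
  | tmul a b =>
    have key : ∀ y : H ⊗[k] H, sliceHom A g.ofConv (sliceHom (A ⊗[k] H) h.ofConv
        ((TensorProduct.assoc k A H H).symm (a ⊗ₜ[k] y))) = pairChar g.ofConv h.ofConv y • a := by
      intro y
      induction y with
      | zero => simp
      | tmul c d => simp [smul_smul, mul_comm]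
      | add x y hx hy => simp only [TensorProduct.tmul_add, map_add, hx, hy, add_smul]
    rw [LinearMap.lTensor_tmul, key, sliceHom_tmul, AlgHom.convMul_apply]
    rfl
  | add x y hx hy => simp only [map_add, hx, hy]

/-- The algebra morphism `I ⊗ S`, the pull-back of functions along `(x, g) ↦ (x, g⁻¹)`. -/
def invHom (A : Type*) [CommRing A] [Algebra k A] (H : Type v) [CommRing H] [HopfAlgebra k H] :
    A ⊗[k] H →ₐ[k] A ⊗[k] H :=
  Algebra.TensorProduct.map (AlgHom.id k A) (HopfAlgebra.antipodeAlgHom k H)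

/-- Needed because `G • M` is described by `M_{g⁻¹}` and `α_g`, whereas the coaction involves `M_g`
and `α_{g⁻¹}`. -/
theorem pairChar_invHom (P : A →ₐ[k] k) (g : HopfPoints k H) (t : A ⊗[k] H) :
    pairChar P g.ofConv (invHom A H t) = pairChar P (g⁻¹).ofConv t := by
  have : (pairChar P g.ofConv).comp (invHom A H) = pairChar P (g⁻¹).ofConv := by
    ext a
    · simp [invHom]
    · simp only [invHom, AlgHom.comp_apply, AlgHom.restrictScalars_apply,
        Algebra.TensorProduct.includeRight_apply, Algebra.TensorProduct.map_tmul, pairChar_tmul]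
      rfl
  exact DFunLike.congr_fun this t

/-- The function on `M × G` given by a polynomial with coefficients in `H`, where the coordinate
functions on `M` are `a j ∈ A`. -/
def prodHom {n : ℕ} (a : Fin n → A) (H : Type v) [CommRing H] [HopfAlgebra k H] :
    MvPolynomial (Fin n) H →+* A ⊗[k] H :=
  MvPolynomial.eval₂Hom (Algebra.TensorProduct.includeRight : H →ₐ[k] A ⊗[k] H).toRingHom
    fun j => a j ⊗ₜ 1

theorem pairChar_prodHom {n : ℕ} (a : Fin n → A) (P : A →ₐ[k] k) (g : HopfPoints k H)
    (F : MvPolynomial (Fin n) H) :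
    pairChar P g.ofConv (prodHom a H F) = g.evalProd (fun j => P (a j)) F := by
  have : (pairChar P g.ofConv : A ⊗[k] H →+* k).comp (prodHom a H) =
      MvPolynomial.eval₂Hom (g.ofConv : H →+* k) (fun j => P (a j)) := by
    ext <;> simp [prodHom]
  exact DFunLike.congr_fun this F

theorem prodHom_surjective {n : ℕ} (a : Fin n → A)
    (ha : Function.Surjective (MvPolynomial.aeval a : MvPolynomial (Fin n) k →ₐ[k] A)) :
    Function.Surjective (prodHom (k := k) a H) := by
  intro t
  induction t with
  | zero => exact ⟨0, map_zero _⟩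
  | add x y hx hy =>
    obtain ⟨F, rfl⟩ := hx
    obtain ⟨F', rfl⟩ := hy
    exact ⟨F + F', map_add _ _ _⟩
  | tmul b c =>
    obtain ⟨p, rfl⟩ := ha b
    -- For `b = p(a)`, the tensor `b ⊗ c` is `p` with coefficients moved to `H`, times the constant
    -- `c`.
    refine ⟨MvPolynomial.map (algebraMap k H) p * MvPolynomial.C c, ?_⟩
    have : (prodHom (k := k) a H).comp (MvPolynomial.map (algebraMap k H)) =
        (Algebra.TensorProduct.includeLeft.comp (MvPolynomial.aeval a) :
          MvPolynomial (Fin n) k →ₐ[k] A ⊗[k] H).toRingHom := by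
      ext j
      · simp [prodHom, Algebra.TensorProduct.algebraMap_apply',
          -Algebra.TensorProduct.algebraMap_apply]
      · simp [prodHom]
    have h := DFunLike.congr_fun this p
    rw [RingHom.comp_apply] at h
    rw [map_mul, h]
    simp [prodHom]

end Slice

/-! ### The maps `θ_g` of a partial coaction -/

namespace PartialCoaction

variable {k : Type u} [Field k] {H : Type v} [CommRing H] [HopfAlgebra k H]
  {A : Type w} [CommRing A] [Algebra k A] (c : PartialCoaction k H A)

theorem theta_eq_sliceHom (g : HopfPoints k H) (a : A) :
    c.theta g a = sliceHom A g.ofConv (c.ρ a) :=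
  rid_lTensor_eq_sliceHom _ _

theorem apply_theta (P : A →ₐ[k] k) (g : HopfPoints k H) (a : A) :
    P (c.theta g a) = pairChar P g.ofConv (c.ρ a) := by
  rw [theta_eq_sliceHom, pairChar_eq_sliceHom]

theorem theta_mul (g : HopfPoints k H) (a b : A) :
    c.theta g (a * b) = c.theta g a * c.theta g b := by
  simp only [theta_eq_sliceHom, c.map_mul, _root_.map_mul]

theorem theta_one (a : A) : c.theta 1 a = a := by
  refine Eq.trans ?_ (c.counit a)
  rfl

/-- Partial coassociativity evaluated at `g` in the middle factor and at `h` in the last. All the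
axioms of the action on characters rest on this identity. -/
theorem theta_theta (g h : HopfPoints k H) (a : A) :
    c.theta g (c.theta h a) = c.theta (g * h) a * c.unitAt g := by
  have := congr_arg (fun t => sliceHom A g.ofConv (sliceHom (A ⊗[k] H) h.ofConv t)) (c.coassoc a)
  simp only [sliceHom_rTensor, _root_.map_mul, sliceHom_sliceHom_comul, sliceHom_tmul, map_one,
    one_smul] at this
  simp only [unitAt, theta_eq_sliceHom, this]

theorem unitAt_mul_self (g : HopfPoints k H) : c.unitAt g * c.unitAt g = c.unitAt g := by
  rw [unitAt, ← theta_mul, one_mul]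

theorem unitAt_one : c.unitAt 1 = 1 := c.theta_one 1

end PartialCoaction

/-! ### Domains of an abstract partial action -/

namespace PartialGroupAction

variable {G : Type v} [Group G] {X : Type u} (α : PartialGroupAction G X)

theorem act_congr {g h : G} (hgh : g = h) {x y : X} (hxy : x = y) (hx : x ∈ α.dom g⁻¹)
    (hy : y ∈ α.dom h⁻¹) : (α.act g ⟨x, hx⟩ : X) = α.act h ⟨y, hy⟩ := by
  subst hgh hxy
  rfl

/-- The image axiom for the pair `g`, `g⁻¹h`; injectivity of `α_g` turns an equality of images into
a pointwise criterion. -/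
theorem act_mem_dom_iff (g h : G) (x : α.dom g⁻¹) :
    (α.act g x : X) ∈ α.dom h ↔ (x : X) ∈ α.dom (g⁻¹ * h) := by
  have him := α.image_act g (g⁻¹ * h)
  rw [mul_inv_cancel_left] at him
  constructor
  · intro hx
    obtain ⟨y, hy, hyx⟩ := him.ge ⟨(α.act g x).2, hx⟩
    rw [← (α.act g).injective (Subtype.ext hyx)]
    exact hy
  · intro hx
    exact (him.le ⟨x, hx, rfl⟩).2

theorem act_inv_mem_dom_iff (g h : G) (x : α.dom g⁻¹⁻¹) :
    (α.act g⁻¹ x : X) ∈ α.dom h ↔ (x : X) ∈ α.dom (g * h) := by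
  simpa using α.act_mem_dom_iff g⁻¹ h x

end PartialGroupAction

/-! ### The partial coaction on the coordinate algebra -/

section FunctionsOnProduct

variable {k : Type u} [Field k] [IsAlgClosed k] {H : Type v} [CommRing H] [HopfAlgebra k H]
  [Algebra.FiniteType k H] [IsReduced H]

theorem hopfPoints_separate (a : H) (ha : ∀ g : HopfPoints k H, g.ofConv a = 0) : a = 0 :=
  eq_zero_of_forall_character fun χ => ha (WithConv.toConv χ)

theorem tensor_ext_of_separates {A : Type*} [CommRing A] [Algebra k A] {ι : Type*}
    (P : ι → A →ₐ[k] k) (hP : ∀ a, (∀ i, P i a = 0) → a = 0) {s t : A ⊗[k] H}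
    (h : ∀ i (g : HopfPoints k H), pairChar (P i) g.ofConv s = pairChar (P i) g.ofConv t) : s = t :=
  pairChar_ext P (fun g : HopfPoints k H => g.ofConv) hP hopfPoints_separate h

theorem coord_tensor_ext {n : ℕ} {M : Set (Fin n → k)} {s t : AffSet.Coord M ⊗[k] H}
    (h : ∀ (x : M) (g : HopfPoints k H),
      pairChar (AffSet.evalAt x) g.ofConv s = pairChar (AffSet.evalAt x) g.ofConv t) : s = t :=
  tensor_ext_of_separates _ (fun _ => AffSet.eq_zero_of_evalAt) h

/-- Separation of points applied twice, so that coassociativity can be tested on triples `(x, g,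
h)`. -/
theorem coord_tensor_tensor_ext {n : ℕ} {M : Set (Fin n → k)}
    {s t : (AffSet.Coord M ⊗[k] H) ⊗[k] H}
    (h : ∀ (x : M) (g h : HopfPoints k H),
      pairChar (pairChar (AffSet.evalAt x) g.ofConv) h.ofConv s =
        pairChar (pairChar (AffSet.evalAt x) g.ofConv) h.ofConv t) : s = t :=
  tensor_ext_of_separates
    (fun z : M × HopfPoints k H => pairChar (AffSet.evalAt z.1) z.2.ofConv)
    (fun _ ha => coord_tensor_ext fun x g => by rw [map_zero]; exact ha (x, g))
    fun z h' => h z.1 z.2 h'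

end FunctionsOnProduct

namespace AlgPartialAction

variable {k : Type u} [Field k] {H : Type v} [CommRing H] [HopfAlgebra k H]

open Classical in
/-- The value `f(α_{g⁻¹} p)` if `p ∈ M_g`, and `0` otherwise. -/
def value (X : AlgPartialAction k H) (f : AffSet.Coord X.carrier) (p : X.carrier)
    (g : HopfPoints k H) : k :=
  -- The double inverse is the domain on which `act g⁻¹` is literally defined; it equals `dom g`
  -- only propositionally.
  if hp : p ∈ X.action.dom g⁻¹⁻¹ then
    AffSet.evalAt (X.action.act g⁻¹ ⟨p, hp⟩ : X.carrier) f else 0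

variable (X : AlgPartialAction k H)

theorem value_of_mem (f : AffSet.Coord X.carrier) {p : X.carrier} {g : HopfPoints k H}
    (hp : p ∈ X.action.dom g⁻¹⁻¹) :
    X.value f p g = AffSet.evalAt (X.action.act g⁻¹ ⟨p, hp⟩ : X.carrier) f :=
  dif_pos hp

theorem value_of_notMem (f : AffSet.Coord X.carrier) {p : X.carrier} {g : HopfPoints k H}
    (hp : p ∉ X.action.dom g) : X.value f p g = 0 :=
  dif_neg (by rwa [inv_inv])

theorem value_inv (f : AffSet.Coord X.carrier) {p : X.carrier} {g : HopfPoints k H}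
    (hp : p ∈ X.action.dom g⁻¹) :
    X.value f p g⁻¹ = AffSet.evalAt (X.action.act g ⟨p, hp⟩ : X.carrier) f := by
  rw [X.value_of_mem f (by rwa [inv_inv]), X.action.act_congr (inv_inv g) rfl]

theorem value_one_left {p : X.carrier} {g : HopfPoints k H} (hp : p ∈ X.action.dom g) :
    X.value 1 p g = 1 := by
  rw [X.value_of_mem 1 (by rwa [inv_inv]), map_one]

/-- Lets the domains be read off from the coaction, hence be compared along any unital morphism. -/
theorem value_one_left_eq_one_iff {p : X.carrier} {g : HopfPoints k H} :
    X.value 1 p g = 1 ↔ p ∈ X.action.dom g := by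
  refine ⟨fun h => ?_, X.value_one_left⟩
  by_contra hp
  rw [X.value_of_notMem 1 hp] at h
  exact zero_ne_one h

theorem value_one_right (f : AffSet.Coord X.carrier) (p : X.carrier) :
    X.value f p 1 = AffSet.evalAt p f := by
  have hp : p ∈ X.action.dom (1 : HopfPoints k H)⁻¹ := by
    rw [inv_one, X.action.dom_one]; trivial
  rw [← inv_one, X.value_inv f hp, X.action.act_one]

theorem value_mul (f f' : AffSet.Coord X.carrier) (p : X.carrier) (g : HopfPoints k H) :
    X.value (f * f') p g = X.value f p g * X.value f' p g := by
  unfold value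
  split_ifs <;> simp

theorem value_add (f f' : AffSet.Coord X.carrier) (p : X.carrier) (g : HopfPoints k H) :
    X.value (f + f') p g = X.value f p g + X.value f' p g := by
  unfold value
  split_ifs <;> simp

theorem value_smul (r : k) (f : AffSet.Coord X.carrier) (p : X.carrier) (g : HopfPoints k H) :
    X.value (r • f) p g = r * X.value f p g := by
  unfold value
  split_ifs <;> simp

/-- The cocycle identity behind the partial coassociativity. -/
theorem value_value {f f' : AffSet.Coord X.carrier} (g h : HopfPoints k H)
    (hf : ∀ p, AffSet.evalAt p f' = X.value f p h) (p : X.carrier) :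
    X.value f' p g = X.value f p (g * h) * X.value 1 p g := by
  by_cases hp : p ∈ X.action.dom g
  · have hp' : p ∈ X.action.dom g⁻¹⁻¹ := by rwa [inv_inv]
    rw [X.value_one_left hp, mul_one, X.value_of_mem _ hp', hf]
    -- For `p ∈ M_g`, `α_{g⁻¹} p ∈ M_h` exactly when `p ∈ M_{gh}`, so the two sides are nonzero
    -- extensions of the same composite or vanish together. Off `M_g` the factor `X.value 1 p g`
    -- kills the right side.
    have hiff := X.action.act_inv_mem_dom_iff g h ⟨p, hp'⟩
    by_cases hy : (X.action.act g⁻¹ ⟨p, hp'⟩ : X.carrier) ∈ X.action.dom h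
    · have hp2 : p ∈ X.action.dom (g * h)⁻¹⁻¹ := by rw [inv_inv]; exact hiff.1 hy
      have hp3 : p ∈ X.action.dom (h⁻¹ * g⁻¹)⁻¹ := by rwa [← mul_inv_rev]
      rw [X.value_of_mem f (by rwa [inv_inv]), X.value_of_mem f hp2,
        X.action.act_act h⁻¹ g⁻¹ p hp' hp3,
        X.action.act_congr (mul_inv_rev g h).symm rfl]
    · rw [X.value_of_notMem f hy, X.value_of_notMem f fun h => hy (hiff.2 h)]
  · rw [X.value_of_notMem _ hp, X.value_of_notMem _ hp, mul_zero]

theorem value_comp {X Y : AlgPartialAction k H} (u : X ⟶ Y) {f : AffSet.Coord Y.carrier}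
    {f' : AffSet.Coord X.carrier} (hf : ∀ x, AffSet.evalAt x f' = AffSet.evalAt (u.toFun x) f)
    (p : X.carrier) (g : HopfPoints k H) : X.value f' p g = Y.value f (u.toFun p) g := by
  by_cases hp : p ∈ X.action.dom g
  · have hp' : p ∈ X.action.dom g⁻¹⁻¹ := by rwa [inv_inv]
    rw [X.value_of_mem _ hp', Y.value_of_mem _ ((u.mem_dom_iff _ _).2 hp'), hf, u.equivariant]
  · rw [X.value_of_notMem _ hp, Y.value_of_notMem _ fun h => hp ((u.mem_dom_iff _ _).1 h)]

section Coaction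

variable [IsAlgClosed k] [Algebra.FiniteType k H]

/-- The equations of `G • M` and of its complement have no common zero on `M × G`, and all
characters of `𝒪(M) ⊗ H` are points of `M × G`, so `exists_indicator` applies. -/
theorem exists_pairChar_eq_indicator : ∃ e : AffSet.Coord X.carrier ⊗[k] H,
    ∀ (p : X.carrier) (g : HopfPoints k H),
      (p ∈ X.action.dom g⁻¹ → pairChar (AffSet.evalAt p) g.ofConv e = 1) ∧
      (p ∉ X.action.dom g⁻¹ → pairChar (AffSet.evalAt p) g.ofConv e = 0) := by
  obtain ⟨S, hS⟩ := X.compatible_isAlgebraic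
  obtain ⟨T, hT⟩ := X.incompatible_isAlgebraic
  have hmem : ∀ (U : Finset (MvPolynomial (Fin X.n) H)) (p : X.carrier) (g : HopfPoints k H),
      (∀ a ∈ prodHom (k := k) (AffSet.coordFun X.carrier) H '' U,
        pairChar (AffSet.evalAt p) g.ofConv a = 0) ↔
        ∀ F ∈ U, g.evalProd p.1 F = 0 := by
    intro U p g
    simp only [Set.forall_mem_image, pairChar_prodHom, AffSet.evalAt_coordFun, Finset.mem_coe]
  have hSmem : ∀ (p : X.carrier) (g : HopfPoints k H),
      p ∈ X.action.dom g⁻¹ ↔ ∀ F ∈ S, g.evalProd p.1 F = 0 := by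
    intro p g
    refine Iff.trans ⟨fun h => ⟨p, h, rfl⟩, ?_⟩ (Set.ext_iff.1 hS (g, p.1))
    rintro ⟨x, hx, hpx⟩
    rwa [Subtype.ext hpx]
  have hTmem : ∀ (p : X.carrier) (g : HopfPoints k H),
      p ∉ X.action.dom g⁻¹ ↔ ∀ F ∈ T, g.evalProd p.1 F = 0 := by
    intro p g
    refine Iff.trans ⟨fun h => ⟨p, h, rfl⟩, ?_⟩ (Set.ext_iff.1 hT (g, p.1))
    rintro ⟨x, hx, hpx⟩
    rwa [Subtype.ext hpx]
  have : Algebra.FiniteType k (AffSet.Coord X.carrier ⊗[k] H) :=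
    Algebra.FiniteType.trans (S := AffSet.Coord X.carrier) inferInstance inferInstance
  obtain ⟨e, he⟩ := exists_indicator (k := k) (prodHom (k := k) (AffSet.coordFun X.carrier) H '' S)
    (prodHom (k := k) (AffSet.coordFun X.carrier) H '' T) (by
      intro χ
      obtain ⟨P, Q, rfl⟩ := exists_eq_pairChar χ
      obtain ⟨p, rfl⟩ := AffSet.exists_evalAt_eq X.isAlgebraic P
      have h1 := hmem S p (WithConv.toConv Q)
      have h2 := hmem T p (WithConv.toConv Q)
      rw [← hSmem] at h1
      rw [← hTmem] at h2
      rintro ⟨h3, h4⟩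
      exact h2.1 h4 (h1.1 h3))
  refine ⟨e, fun p g => ⟨fun h => (he _).1 ?_, fun h => (he _).2 ?_⟩⟩
  · rwa [hmem, ← hSmem]
  · rwa [hmem, ← hTmem]

theorem exists_pairChar_eq_value (f : AffSet.Coord X.carrier) :
    ∃ t : AffSet.Coord X.carrier ⊗[k] H, ∀ (p : X.carrier) (g : HopfPoints k H),
      pairChar (AffSet.evalAt p) g.ofConv t = X.value f p g := by
  obtain ⟨e, he⟩ := X.exists_pairChar_eq_indicator
  obtain ⟨F, hF⟩ := X.act_polynomial_joint
  obtain ⟨q, rfl⟩ := Ideal.Quotient.mk_surjective f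
  -- The polynomials `F` compute `α` only on `G • M`; the factor `e` cuts their composite with `q`
  -- off to zero elsewhere, and `invHom` replaces `g` by `g⁻¹`.
  refine ⟨invHom _ H (e * MvPolynomial.aeval
    (fun j => prodHom (k := k) (AffSet.coordFun X.carrier) H (F j)) q), fun p g => ?_⟩
  rw [pairChar_invHom, map_mul]
  by_cases hp : p ∈ X.action.dom g
  · have hp' : p ∈ X.action.dom g⁻¹⁻¹ := by rwa [inv_inv]
    rw [(he _ _).1 hp', one_mul, X.value_of_mem _ hp', AffSet.evalAt_mk,
      ← AlgHom.comp_apply, MvPolynomial.comp_aeval]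
    simp only [pairChar_prodHom, AffSet.evalAt_coordFun, ← hF g⁻¹ ⟨p, hp'⟩]
    rfl
  · rw [(he _ _).2 (by rwa [inv_inv]), zero_mul, X.value_of_notMem _ hp]

variable [IsReduced H]

/-- The partial coaction on the coordinate algebra of an algebraic partial action. -/
def coordRho : AffSet.Coord X.carrier →ₗ[k] AffSet.Coord X.carrier ⊗[k] H where
  toFun f := (X.exists_pairChar_eq_value f).choose
  map_add' f f' := coord_tensor_ext fun p g => by
    rw [map_add, (X.exists_pairChar_eq_value f).choose_spec,
      (X.exists_pairChar_eq_value f').choose_spec,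
      (X.exists_pairChar_eq_value (f + f')).choose_spec, value_add]
  map_smul' r f := coord_tensor_ext fun p g => by
    rw [map_smul, (X.exists_pairChar_eq_value f).choose_spec,
      (X.exists_pairChar_eq_value (r • f)).choose_spec, value_smul, RingHom.id_apply, smul_eq_mul]

theorem pairChar_coordRho (f : AffSet.Coord X.carrier) (p : X.carrier) (g : HopfPoints k H) :
    pairChar (AffSet.evalAt p) g.ofConv (X.coordRho f) = X.value f p g :=
  (X.exists_pairChar_eq_value f).choose_spec p g

/-- The partial coaction of `H` on the coordinate algebra of an algebraic partial action. -/
def coordCoaction : PartialCoaction k H (AffSet.Coord X.carrier) where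
  ρ := X.coordRho
  map_mul a b := coord_tensor_ext fun p g => by
    rw [pairChar_coordRho, map_mul, pairChar_coordRho, pairChar_coordRho, value_mul]
  counit a := AffSet.coord_ext fun p => by
    -- The counit of `H` is the identity of `G`, so the axiom is the value at `g = 1`.
    have h := pairChar_eq_rid (AffSet.evalAt p) (1 : HopfPoints k H).ofConv (X.coordRho a)
    rw [pairChar_coordRho, value_one_right] at h
    exact h.symm
  coassoc a := coord_tensor_tensor_ext fun p g h => by
    rw [pairChar_eq_sliceHom, sliceHom_rTensor, pairChar_coordRho, pairChar_eq_sliceHom, map_mul,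
      map_mul, sliceHom_tmul, map_one, one_smul, pairChar_coordRho, pairChar_eq_sliceHom,
      sliceHom_sliceHom_comul, ← pairChar_eq_sliceHom, pairChar_coordRho]
    refine X.value_value g h (fun q => ?_) p
    rw [← pairChar_eq_sliceHom, pairChar_coordRho]

/-- The partial comodule algebra `𝒪(M)` of an algebraic partial action on `M`. -/
abbrev coordObj : ParComodAlg k H where
  A := AffSet.Coord X.carrier
  coaction := X.coordCoaction

theorem evalAt_theta (f : AffSet.Coord X.carrier) (p : X.carrier) (g : HopfPoints k H) :
    AffSet.evalAt p (X.coordCoaction.theta g f) = X.value f p g := by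
  rw [PartialCoaction.apply_theta]
  exact X.pairChar_coordRho f p g

end Coaction

end AlgPartialAction

/-! ### The coordinate functor -/

namespace AlgPartialAction

variable {k : Type u} [Field k] [IsAlgClosed k] {H : Type v} [CommRing H] [HopfAlgebra k H]
  [Algebra.FiniteType k H] [IsReduced H]

/-- An algebra morphism `𝒪(N) → 𝒪(M)` given by `u : M → N` is a morphism of partial comodule
algebras if and only if it intertwines the functions `value`. -/
theorem comm_iff {X Y : AlgPartialAction k H}
    {φ : AffSet.Coord Y.carrier →ₐ[k] AffSet.Coord X.carrier} {u : X.carrier → Y.carrier}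
    (hu : ∀ x a, AffSet.evalAt x (φ a) = AffSet.evalAt (u x) a) (a : AffSet.Coord Y.carrier) :
    X.coordRho (φ a) = LinearMap.rTensor H φ.toLinearMap (Y.coordRho a) ↔
      ∀ p g, X.value (φ a) p g = Y.value a (u p) g := by
  have key : ∀ (p : X.carrier) (g : HopfPoints k H), pairChar (AffSet.evalAt p) g.ofConv
      (LinearMap.rTensor H φ.toLinearMap (Y.coordRho a)) = Y.value a (u p) g := by
    intro p g
    rw [pairChar_eq_sliceHom, sliceHom_rTensor, AlgHom.toLinearMap_apply, hu,
      ← pairChar_eq_sliceHom, pairChar_coordRho]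
  constructor
  · intro h p g
    rw [← pairChar_coordRho, h, key]
  · intro h
    refine coord_tensor_ext fun p g => ?_
    rw [key, pairChar_coordRho, h]

/-- The morphism of partial comodule algebras `f ↦ f ∘ u`. -/
def coordMap {X Y : AlgPartialAction k H} (u : X ⟶ Y) : Y.coordObj ⟶ X.coordObj where
  toAlgHom := (AffSet.exists_pullback u.polynomial).choose
  comm a := (comm_iff (AffSet.exists_pullback u.polynomial).choose_spec a).2 fun p g =>
    value_comp u (fun x => (AffSet.exists_pullback u.polynomial).choose_spec x a) p g

theorem evalAt_coordMap {X Y : AlgPartialAction k H} (u : X ⟶ Y) (x : X.carrier)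
    (a : AffSet.Coord Y.carrier) :
    AffSet.evalAt x ((coordMap u).toAlgHom a) = AffSet.evalAt (u.toFun x) a :=
  (AffSet.exists_pullback u.polynomial).choose_spec x a

theorem coordObj_hom_ext {A : ParComodAlg k H} {X : AlgPartialAction k H} {f f' : A ⟶ X.coordObj}
    (h : ∀ (x : X.carrier) a, AffSet.evalAt x (f.toAlgHom a) = AffSet.evalAt x (f'.toAlgHom a)) :
    f = f' :=
  ParComodAlg.Hom.ext <| AlgHom.ext fun a => AffSet.coord_ext fun x => h x a

variable (k H) in
/-- The functor sending an algebraic partial action on `M` to the partial comodule algebra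
`𝒪(M)`. -/
def coordFunctor : (AlgPartialAction k H)ᵒᵖ ⥤ ParComodAlg k H where
  obj X := X.unop.coordObj
  map u := coordMap u.unop
  map_id X := coordObj_hom_ext fun x a => evalAt_coordMap _ x a
  map_comp {X Y Z} u u' := coordObj_hom_ext fun x a => by
    refine (evalAt_coordMap _ x a).trans ?_
    refine Eq.trans ?_ (evalAt_coordMap u'.unop x ((coordMap u.unop).toAlgHom a)).symm
    exact (evalAt_coordMap u.unop _ a).symm

instance : (coordFunctor k H).Faithful where
  map_injective {X Y} u u' h := by
    refine Quiver.Hom.unop_inj (Hom.ext (funext fun x => AffSet.evalAt_injective ?_))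
    ext a
    have := congr_arg (fun f => AffSet.evalAt x (ParComodAlg.Hom.toAlgHom f a)) h
    exact ((evalAt_coordMap u.unop x a).symm.trans this).trans (evalAt_coordMap u'.unop x a)

/-- A morphism of partial comodule algebras between coordinate algebras is induced by a morphism
of partial actions. -/
theorem exists_coordMap_eq {X Y : AlgPartialAction k H} (f : Y.coordObj ⟶ X.coordObj) :
    ∃ u : X ⟶ Y, coordMap u = f := by
  obtain ⟨φ, hφ⟩ : ∃ φ : AffSet.Coord Y.carrier →ₐ[k] AffSet.Coord X.carrier, φ = f.toAlgHom :=
    ⟨f.toAlgHom, rfl⟩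
  have hcomm : ∀ a, X.coordRho (φ a) = LinearMap.rTensor H φ.toLinearMap (Y.coordRho a) := by
    rw [hφ]
    exact f.comm
  obtain ⟨u, hu, huf⟩ := AffSet.exists_polynomialMap Y.isAlgebraic φ
  have hval : ∀ a p g, X.value (φ a) p g = Y.value a (u p) g :=
    fun a => (comm_iff huf a).1 (hcomm a)
  have hdom : ∀ g x, u x ∈ Y.action.dom g ↔ x ∈ X.action.dom g := by
    intro g x
    -- Unitality of `φ` is what gives equality of domains rather than an inclusion.
    rw [← value_one_left_eq_one_iff, ← hval, map_one, value_one_left_eq_one_iff]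
  refine ⟨⟨u, hu, hdom, fun g x => AffSet.evalAt_injective (AlgHom.ext fun a => ?_)⟩, ?_⟩
  · rw [← huf, ← X.value_inv _ x.2, hval, Y.value_inv]
  · refine coordObj_hom_ext fun x a => (evalAt_coordMap _ x a).trans ?_
    rw [← hφ]
    exact (huf x a).symm

instance : (coordFunctor k H).Full where
  map_surjective {X Y} f := by
    obtain ⟨u, hu⟩ := exists_coordMap_eq (X := Y.unop) (Y := X.unop) f
    exact ⟨u.op, hu⟩

theorem isCoordinateCoaction_refl (X : AlgPartialAction k H) :
    IsCoordinateCoaction X X.coordObj AlgEquiv.refl := fun f p g =>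
  ⟨fun hp => (X.evalAt_theta f p g).trans (X.value_of_mem f hp),
    fun hp => (X.evalAt_theta f p g).trans (X.value_of_notMem f hp)⟩

end AlgPartialAction

/-! ### The partial action on the spectrum -/

/-- The transport of a partial action along a bijection. -/
def PartialGroupAction.comap {G : Type v} [Group G] {X : Type*} {Y : Type*}
    (α : PartialGroupAction G X) (e : Y ≃ X) : PartialGroupAction G Y where
  dom g := e ⁻¹' α.dom g
  act g :=
    { toFun := fun y => ⟨e.symm (α.act g ⟨e y, y.2⟩), by simp⟩
      invFun := fun y => ⟨e.symm ((α.act g).symm ⟨e y, y.2⟩), by simp⟩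
      left_inv := fun y => by simp
      right_inv := fun y => by simp }
  dom_one := by rw [α.dom_one, Set.preimage_univ]
  act_one y := by
    change e.symm (α.act 1 ⟨e y, y.2⟩) = y
    rw [α.act_one, e.symm_apply_apply]
  image_act g h := by
    ext y
    have := Set.ext_iff.1 (α.image_act g h) (e y)
    refine Iff.trans ⟨?_, ?_⟩ this
    · rintro ⟨x, hx, rfl⟩
      exact ⟨⟨e x, x.2⟩, hx, by simp⟩
    · rintro ⟨x, hx, hxy⟩
      refine ⟨⟨e.symm x, by simp⟩, by simpa using hx, ?_⟩
      simp only [Equiv.coe_fn_mk, Equiv.apply_symm_apply, Subtype.coe_eta]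
      rw [show (α.act g x : X) = e y from hxy, e.symm_apply_apply]
  act_act g h x hx hx' hy := by
    have hy' : (α.act h ⟨e x, hx⟩ : X) ∈ α.dom g⁻¹ := by simpa using hy
    simpa using α.act_act g h (e x) hx hx' hy'

namespace PartialCoaction

variable {k : Type u} [Field k] {H : Type v} [CommRing H] [HopfAlgebra k H]
  {A : Type w} [CommRing A] [Algebra k A] (c : PartialCoaction k H A)

/-- The character `P ∘ θ_g`, for a character `P` with `P(1_g) = 1`. -/
def compTheta (g : HopfPoints k H) (P : A →ₐ[k] k) (hP : P (c.unitAt g) = 1) : A →ₐ[k] k :=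
  AlgHom.ofLinearMap (P.toLinearMap ∘ₗ c.theta g) hP fun a b => by
    rw [LinearMap.comp_apply, c.theta_mul]
    exact _root_.map_mul P _ _

@[simp]
theorem compTheta_apply (g : HopfPoints k H) (P : A →ₐ[k] k) (hP : P (c.unitAt g) = 1) (a : A) :
    c.compTheta g P hP a = P (c.theta g a) := rfl

/-- On characters with `P(1_g) = 1` the idempotent in `theta_theta` disappears and `θ` becomes
multiplicative in the group element. -/
theorem compTheta_theta (g h : HopfPoints k H) (P : A →ₐ[k] k) (hP : P (c.unitAt g) = 1) (a : A) :
    c.compTheta g P hP (c.theta h a) = P (c.theta (g * h) a) := by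
  rw [compTheta_apply, theta_theta, _root_.map_mul, hP, mul_one]

theorem compTheta_unitAt (g h : HopfPoints k H) (P : A →ₐ[k] k) (hP : P (c.unitAt g) = 1) :
    c.compTheta g P hP (c.unitAt h) = P (c.unitAt (g * h)) :=
  c.compTheta_theta g h P hP 1

theorem compTheta_compTheta (g h : HopfPoints k H) (P : A →ₐ[k] k) (hP : P (c.unitAt g) = 1) (hQ)
    (hgh : g * h = 1) : c.compTheta h (c.compTheta g P hP) hQ = P := by
  ext a
  rw [compTheta_apply, compTheta_theta, hgh, theta_one]

/-- As `1_g` is idempotent, `P(1_g)` is `0` or `1`, and `θ_g(a)` is a multiple of `1_g`. -/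
theorem apply_theta_eq_zero (g : HopfPoints k H) (P : A →ₐ[k] k) (hP : P (c.unitAt g) ≠ 1)
    (a : A) : P (c.theta g a) = 0 := by
  have h0 : P (c.unitAt g) = 0 := by
    have := congr_arg P (c.unitAt_mul_self g)
    rw [_root_.map_mul] at this
    by_contra h
    exact hP (mul_left_cancel₀ h (by rw [this, mul_one]))
  rw [← one_mul a, c.theta_mul, _root_.map_mul]
  exact mul_eq_zero_of_left h0 _

/-- The partial action of `G` on the characters of a partial comodule algebra. -/
def spectrumAction : PartialGroupAction (HopfPoints k H) (A →ₐ[k] k) where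
  dom g := {P | P (c.unitAt g) = 1}
  act g :=
    -- Using `θ_{g⁻¹}` on all of `A` loses nothing: `θ_{g⁻¹}(1_g) = 1_{g⁻¹}`, so `θ_{g⁻¹}(1_g a) =
    -- θ_{g⁻¹}(a)`.
    { toFun := fun P => ⟨c.compTheta g⁻¹ P P.2, by
        change c.compTheta g⁻¹ P P.2 (c.unitAt g) = 1
        rw [compTheta_unitAt, inv_mul_cancel, unitAt_one, map_one]⟩
      invFun := fun P => ⟨c.compTheta g P P.2, by
        change c.compTheta g P P.2 (c.unitAt g⁻¹) = 1
        rw [compTheta_unitAt, mul_inv_cancel, unitAt_one, map_one]⟩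
      left_inv := fun P => Subtype.ext (c.compTheta_compTheta _ _ _ _ _ (inv_mul_cancel g))
      right_inv := fun P => Subtype.ext (c.compTheta_compTheta _ _ _ _ _ (mul_inv_cancel g)) }
  dom_one := by
    ext P
    simp [unitAt_one]
  act_one P := by
    ext a
    exact congr_arg P.1 (by rw [inv_one, theta_one])
  image_act g h := by
    ext Q
    constructor
    · rintro ⟨P, hP, rfl⟩
      refine ⟨Subtype.property _, ?_⟩
      change c.compTheta g⁻¹ P P.2 (c.unitAt (g * h)) = 1
      rw [compTheta_unitAt, inv_mul_cancel_left]
      exact hP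
    · rintro ⟨hQ, hQ'⟩
      refine ⟨⟨c.compTheta g Q hQ, ?_⟩, ?_, c.compTheta_compTheta _ _ _ _ _ (mul_inv_cancel g)⟩
      · change c.compTheta g Q hQ (c.unitAt g⁻¹) = 1
        rw [compTheta_unitAt, mul_inv_cancel, unitAt_one, map_one]
      · exact (c.compTheta_unitAt g h Q hQ).trans hQ'
  act_act g h P hP hP' hy := by
    ext a
    change c.compTheta h⁻¹ P hP (c.theta g⁻¹ a) = P (c.theta (g * h)⁻¹ a)
    rw [compTheta_theta, mul_inv_rev]

end PartialCoaction

/-! ### Algebraic partial actions built from partial coactions -/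

section Model

variable {k : Type u} [Field k] {H : Type v} [CommRing H] [HopfAlgebra k H]
  {n : ℕ} {M : Set (Fin n → k)}

/-- The zeros in `G × M` of an element of `𝒪(M) ⊗ H` form an algebraic set. -/
theorem isAlgebraicInProd_zeros (hM : AffSet.IsAlgebraic M) (t : AffSet.Coord M ⊗[k] H) :
    IsAlgebraicInProd {z : HopfPoints k H × (Fin n → k) |
      ∃ x : M, pairChar (AffSet.evalAt x) z.1.ofConv t = 0 ∧ z.2 = x} := by
  classical
  obtain ⟨S, hS⟩ := hM
  obtain ⟨F, rfl⟩ := prodHom_surjective (H := H) _ (AffSet.aeval_coordFun_surjective (M := M)) t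
  refine ⟨insert F (S.image (MvPolynomial.map (algebraMap k H))), Set.ext fun z => ?_⟩
  have hconst : ∀ p : MvPolynomial (Fin n) k,
      z.1.evalProd z.2 (MvPolynomial.map (algebraMap k H) p) = MvPolynomial.eval z.2 p := by
    intro p
    rw [HopfPoints.evalProd, MvPolynomial.eval₂_map, AlgHom.comp_algebraMap]
    rfl
  have hz := Set.ext_iff.1 hS z.2
  simp only [Set.mem_ofPred_eq] at hz
  simp only [Set.mem_ofPred_eq, pairChar_prodHom, AffSet.evalAt_coordFun, Finset.forall_mem_insert,
    Finset.forall_mem_image, hconst, ← hz]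
  constructor
  · rintro ⟨x, hx, hzx⟩
    rw [hzx]
    exact ⟨hx, x.2⟩
  · rintro ⟨hF, hzM⟩
    exact ⟨⟨z.2, hzM⟩, hF, rfl⟩

variable {A : Type w} [CommRing A] [Algebra k A]

/-- The points of `M` are the characters of an algebra isomorphic to `𝒪(M)`. -/
def AffSet.charEquiv (hM : AffSet.IsAlgebraic M) (φ : AffSet.Coord M ≃ₐ[k] A) :
    M ≃ (A →ₐ[k] k) :=
  (AffSet.pointsEquiv hM).trans (φ.arrowCongr AlgEquiv.refl)

theorem AffSet.charEquiv_apply (hM : AffSet.IsAlgebraic M) (φ : AffSet.Coord M ≃ₐ[k] A) (x : M)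
    (a : A) : AffSet.charEquiv hM φ x a = AffSet.evalAt x (φ.symm a) := rfl

theorem AffSet.charEquiv_map_apply (hM : AffSet.IsAlgebraic M) (φ : AffSet.Coord M ≃ₐ[k] A) (x : M)
    (f : AffSet.Coord M) : AffSet.charEquiv hM φ x (φ f) = AffSet.evalAt x f := by
  rw [AffSet.charEquiv_apply, φ.symm_apply_apply]

theorem pairChar_evalAt_rTensor_symm (hM : AffSet.IsAlgebraic M) (φ : AffSet.Coord M ≃ₐ[k] A)
    (x : M) (g : HopfPoints k H) (t : A ⊗[k] H) :
    pairChar (AffSet.evalAt x) g.ofConv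
      (LinearMap.rTensor H φ.symm.toAlgHom.toLinearMap t) =
      pairChar (AffSet.charEquiv hM φ x) g.ofConv t := by
  rw [pairChar_eq_sliceHom, sliceHom_rTensor, pairChar_eq_sliceHom]
  rfl

theorem charEquiv_comap_act (hM : AffSet.IsAlgebraic M) (φ : AffSet.Coord M ≃ₐ[k] A)
    (c : PartialCoaction k H A) (g : HopfPoints k H)
    (x : (c.spectrumAction.comap (AffSet.charEquiv hM φ)).dom g⁻¹) (a : A) :
    AffSet.charEquiv hM φ ((c.spectrumAction.comap (AffSet.charEquiv hM φ)).act g x : M) a =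
      AffSet.charEquiv hM φ x.1 (c.theta g⁻¹ a) := by
  change AffSet.charEquiv hM φ ((AffSet.charEquiv hM φ).symm _) a = _
  rw [Equiv.apply_symm_apply]
  rfl

/-- The algebraic partial action on an algebraic set whose coordinate algebra carries a partial
coaction. -/
abbrev AlgPartialAction.ofModel (hM : AffSet.IsAlgebraic M) (φ : AffSet.Coord M ≃ₐ[k] A)
    (c : PartialCoaction k H A) : AlgPartialAction k H where
  n := n
  carrier := M
  isAlgebraic := hM
  action := c.spectrumAction.comap (AffSet.charEquiv hM φ)
  dom_isAlgebraic g := by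
    -- The idempotent `1_g` takes only the values `0` and `1`, so `M_g` and its complement are the
    -- zeros of `1_g - 1` and `1_g`. The same argument with `ρ(1)` handles `G • M`.
    convert AffSet.isAlgebraic_zeros hM (φ.symm (c.unitAt g - 1)) using 2
    ext x
    change AffSet.charEquiv hM φ x (c.unitAt g) = 1 ↔ AffSet.charEquiv hM φ x (c.unitAt g - 1) = 0
    rw [map_sub, map_one, sub_eq_zero]
  compl_dom_isAlgebraic g := by
    convert AffSet.isAlgebraic_zeros hM (φ.symm (c.unitAt g)) using 2
    ext x
    change AffSet.charEquiv hM φ x (c.unitAt g) ≠ 1 ↔ AffSet.charEquiv hM φ x (c.unitAt g) = 0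
    exact ⟨fun h => c.apply_theta_eq_zero g _ h 1, fun h => by rw [h]; exact zero_ne_one⟩
  act_polynomial g := by
    choose F hF using fun j => Ideal.Quotient.mk_surjective
      (φ.symm (c.theta g⁻¹ (φ (AffSet.coordFun M j))))
    refine ⟨F, fun x j => ?_⟩
    rw [← AffSet.evalAt_mk, hF, ← AffSet.charEquiv_apply hM, ← charEquiv_comap_act,
      AffSet.charEquiv_map_apply, AffSet.evalAt_coordFun_apply]
  compatible_isAlgebraic := by
    convert isAlgebraicInProd_zeros hM
      (LinearMap.rTensor H φ.symm.toAlgHom.toLinearMap (invHom A H (c.ρ 1 - 1))) using 1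
    ext z
    refine exists_congr fun x => and_congr_left fun _ => ?_
    rw [pairChar_evalAt_rTensor_symm hM, pairChar_invHom, map_sub, sub_eq_zero,
      ← c.apply_theta, map_one (pairChar _ _)]
    rfl
  incompatible_isAlgebraic := by
    convert isAlgebraicInProd_zeros hM
      (LinearMap.rTensor H φ.symm.toAlgHom.toLinearMap (invHom A H (c.ρ 1))) using 1
    ext z
    refine exists_congr fun x => and_congr_left fun _ => ?_
    rw [pairChar_evalAt_rTensor_symm hM, pairChar_invHom, ← c.apply_theta]
    exact ⟨fun h => c.apply_theta_eq_zero z.1⁻¹ _ h 1,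
      fun h h' => zero_ne_one (h.symm.trans h')⟩
  act_polynomial_joint := by
    choose F hF using fun j => prodHom_surjective (H := H) _
      (AffSet.aeval_coordFun_surjective (M := M))
      (LinearMap.rTensor H φ.symm.toAlgHom.toLinearMap
        (invHom A H (c.ρ (φ (AffSet.coordFun M j)))))
    refine ⟨F, fun g x j => ?_⟩
    rw [← AffSet.evalAt_coordFun x.1, ← pairChar_prodHom, hF, pairChar_evalAt_rTensor_symm hM,
      pairChar_invHom, ← c.apply_theta, ← charEquiv_comap_act, AffSet.charEquiv_map_apply,
      AffSet.evalAt_coordFun_apply]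

variable [IsAlgClosed k] [Algebra.FiniteType k H] [IsReduced H] [Algebra.FiniteType k A]
  [IsReduced A]

/-- Both sides agree at every `(P, g)`: on `M_g` by the formula for the action, off `M_g` because
both vanish. This makes `φ` an isomorphism of partial comodule algebras. -/
theorem rho_comp_eq_rTensor_coordRho (hM : AffSet.IsAlgebraic M) (φ : AffSet.Coord M ≃ₐ[k] A)
    (c : PartialCoaction k H A) (f : AffSet.Coord M) :
    c.ρ (φ f) = LinearMap.rTensor H φ.toAlgHom.toLinearMap
      ((AlgPartialAction.ofModel hM φ c).coordRho f) := by
  refine tensor_ext_of_separates (fun P : A →ₐ[k] k => P) (fun _ => eq_zero_of_forall_character)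
    fun P g => ?_
  obtain ⟨x, rfl⟩ := (AffSet.charEquiv hM φ).surjective P
  have hR : pairChar (AffSet.charEquiv hM φ x) g.ofConv (LinearMap.rTensor H φ.toAlgHom.toLinearMap
      ((AlgPartialAction.ofModel hM φ c).coordRho f)) =
      (AlgPartialAction.ofModel hM φ c).value f x g := by
    rw [← AlgPartialAction.pairChar_coordRho, pairChar_eq_sliceHom, sliceHom_rTensor,
      pairChar_eq_sliceHom]
    exact AffSet.charEquiv_map_apply hM φ x _
  rw [hR, ← c.apply_theta]
  by_cases hx : x ∈ (AlgPartialAction.ofModel hM φ c).action.dom g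
  · have hx' : x ∈ (AlgPartialAction.ofModel hM φ c).action.dom g⁻¹⁻¹ := by rwa [inv_inv]
    rw [AlgPartialAction.value_of_mem _ _ hx']
    have h := charEquiv_comap_act hM φ c g⁻¹ ⟨x, hx'⟩ (φ f)
    rw [AffSet.charEquiv_map_apply] at h
    refine Eq.trans ?_ h.symm
    exact congr_arg (fun g' => AffSet.charEquiv hM φ x (c.theta g' (φ f))) (inv_inv g).symm
  · rw [AlgPartialAction.value_of_notMem _ _ hx]
    exact c.apply_theta_eq_zero g _ hx _

end Model

/-- An invertible morphism of partial comodule algebras is an isomorphism. -/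
def ParComodAlg.isoMk {k : Type u} [Field k] {H : Type v} [CommRing H] [HopfAlgebra k H]
    {A B : ParComodAlg k H} (φ : A.A ≃ₐ[k] B.A)
    (h : ∀ a, B.coaction.ρ (φ a) = LinearMap.rTensor H φ.toAlgHom.toLinearMap (A.coaction.ρ a)) :
    A ≅ B where
  hom := ⟨φ.toAlgHom, h⟩
  inv := ⟨φ.symm.toAlgHom, fun b => by
    obtain ⟨a, rfl⟩ := φ.surjective b
    rw [h, ← LinearMap.comp_apply, ← LinearMap.rTensor_comp]
    have : φ.symm.toAlgHom.toLinearMap ∘ₗ φ.toAlgHom.toLinearMap = LinearMap.id := by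
      ext a
      exact φ.symm_apply_apply a
    rw [this, LinearMap.rTensor_id, LinearMap.id_apply]
    exact congr_arg _ (φ.symm_apply_apply a)⟩
  hom_inv_id := ParComodAlg.Hom.ext (AlgHom.ext φ.symm_apply_apply)
  inv_hom_id := ParComodAlg.Hom.ext (AlgHom.ext φ.apply_symm_apply)

/-- The algebra isomorphism underlying an isomorphism of partial comodule algebras. -/
def ParComodAlg.algEquivOfIso {k : Type u} [Field k] {H : Type v} [CommRing H] [HopfAlgebra k H]
    {A B : ParComodAlg k H} (i : A ≅ B) : A.A ≃ₐ[k] B.A :=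
  AlgEquiv.ofAlgHom i.hom.toAlgHom i.inv.toAlgHom (congr_arg Hom.toAlgHom i.inv_hom_id)
    (congr_arg Hom.toAlgHom i.hom_inv_id)

/-! ### Essential surjectivity and description of the quasi-inverse -/

namespace AlgPartialAction

variable {k : Type u} [Field k] [IsAlgClosed k] {H : Type v} [CommRing H] [HopfAlgebra k H]
  [Algebra.FiniteType k H] [IsReduced H]

instance : (coordFunctor k H).EssSurj where
  mem_essImage A := by
    obtain ⟨n, M, hM, ⟨φ⟩⟩ := AffSet.exists_coord_equiv (k := k) A.A
    exact ⟨Opposite.op (ofModel hM φ A.coaction), ⟨ParComodAlg.isoMk (A := coordObj _) φ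
      (rho_comp_eq_rTensor_coordRho hM φ A.coaction)⟩⟩

instance : (coordFunctor k H).IsEquivalence where

/-- The points of `M` are the characters of a partial comodule algebra isomorphic to `𝒪(M)`. -/
def charEquivOfIso {X : AlgPartialAction k H} {A : ParComodAlg k H} (i : X.coordObj ≅ A) :
    X.carrier ≃ (A.A →ₐ[k] k) :=
  AffSet.charEquiv X.isAlgebraic (ParComodAlg.algEquivOfIso i)

theorem charEquivOfIso_apply {X : AlgPartialAction k H} {A : ParComodAlg k H} (i : X.coordObj ≅ A)
    (x : X.carrier) (a : A.A) : charEquivOfIso i x a = AffSet.evalAt x (i.inv.toAlgHom a) := rfl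

theorem charEquivOfIso_theta {X : AlgPartialAction k H} {A : ParComodAlg k H}
    (i : X.coordObj ≅ A) (x : X.carrier) (g : HopfPoints k H) (a : A.A) :
    charEquivOfIso i x (A.coaction.theta g a) = X.value (i.inv.toAlgHom a) x g := by
  rw [charEquivOfIso_apply, ← X.evalAt_theta, PartialCoaction.theta_eq_sliceHom]
  refine congr_arg (AffSet.evalAt x) (Eq.trans ?_ (X.coordCoaction.theta_eq_sliceHom _ _).symm)
  refine Eq.trans ?_ (congr_arg (sliceHom X.coordObj.A g.ofConv) (i.inv.comm a)).symm
  rw [sliceHom_rTensor]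
  rfl

/-- Any isomorphism `𝒪(X) ≅ A` forces `X` to be the spectrum of `A`, so no knowledge of how the
quasi-inverse was chosen is needed. -/
theorem isSpectrumAction_charEquivOfIso {X : AlgPartialAction k H} {A : ParComodAlg k H}
    (i : X.coordObj ≅ A) : IsSpectrumAction A X (charEquivOfIso i) where
  regular f := by
    constructor
    · rintro ⟨F, hF⟩
      refine ⟨ParComodAlg.algEquivOfIso i (Ideal.Quotient.mk _ F : AffSet.Coord X.carrier),
        fun x => ?_⟩
      rw [hF, ← AffSet.evalAt_mk]
      exact (AffSet.charEquiv_map_apply X.isAlgebraic (ParComodAlg.algEquivOfIso i) x _).symm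
    · rintro ⟨a, ha⟩
      obtain ⟨F, hF⟩ := Ideal.Quotient.mk_surjective
        (show AffSet.Coord X.carrier from i.inv.toAlgHom a)
      refine ⟨F, fun x => ?_⟩
      rw [ha, ← AffSet.evalAt_mk, hF]
      rfl
  mem_dom_iff g x := by
    rw [PartialCoaction.unitAt, charEquivOfIso_theta, ← value_one_left_eq_one_iff]
    exact iff_of_eq (congr_arg (X.value · x g = 1) (map_one i.inv.toAlgHom).symm)
  act_apply g x a _ := by
    rw [charEquivOfIso_theta, X.value_inv _ x.2]
    rfl

end AlgPartialAction

end

theorem mainTheorem6 (k : Type u) [Field k] [IsAlgClosed k]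
    (H : Type v) [CommRing H] [HopfAlgebra k H] [Algebra.FiniteType k H] [IsReduced H] :
    ∃ E : (AlgPartialAction k H)ᵒᵖ ≌ ParComodAlg k H,
      (∃ φ : ∀ X : AlgPartialAction k H,
          AffSet.Coord X.carrier ≃ₐ[k] (E.functor.obj (Opposite.op X)).A,
        (∀ X, IsCoordinateCoaction X (E.functor.obj (Opposite.op X)) (φ X)) ∧
        ∀ (X Y : AlgPartialAction k H) (u : X ⟶ Y) (f : AffSet.Coord Y.carrier) (x : X.carrier),
          AffSet.evalAt x ((φ X).symm ((E.functor.map u.op).toAlgHom (φ Y f))) =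
            AffSet.evalAt (u.toFun x) f) ∧
      (∃ ψ : ∀ A : ParComodAlg k H,
          (E.inverse.obj A).unop.carrier ≃ (A.A →ₐ[k] k),
        (∀ A, IsSpectrumAction A (E.inverse.obj A).unop (ψ A)) ∧
        ∀ (A B : ParComodAlg k H) (f : A ⟶ B) (x : (E.inverse.obj B).unop.carrier),
          ψ A ((E.inverse.map f).unop.toFun x) = (ψ B x).comp f.toAlgHom) := by
  refine ⟨(AlgPartialAction.coordFunctor k H).asEquivalence,
    ⟨fun X => AlgEquiv.refl, AlgPartialAction.isCoordinateCoaction_refl,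
      fun X Y u f x => AlgPartialAction.evalAt_coordMap u x f⟩, ?_⟩
  let E := (AlgPartialAction.coordFunctor k H).asEquivalence
  -- Naturality of the counit; evaluated at a point of the chosen set for `B`, it becomes the
  -- naturality of `ψ`.
  have hE : ∀ {A B : ParComodAlg k H} (f : A ⟶ B),
      (E.counitIso.app A).inv ≫ AlgPartialAction.coordMap (E.inverse.map f).unop =
        f ≫ (E.counitIso.app B).inv :=
    fun f => (E.counitIso.inv.naturality f).symm
  refine ⟨fun A => AlgPartialAction.charEquivOfIso
    (X := (E.inverse.obj A).unop) (E.counitIso.app A),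
    fun A => AlgPartialAction.isSpectrumAction_charEquivOfIso _, fun A B f x => ?_⟩
  ext a
  have h := congr_arg (fun q => AffSet.evalAt x (ParComodAlg.Hom.toAlgHom q a)) (hE f)
  exact (AlgPartialAction.evalAt_coordMap (E.inverse.map f).unop x _).symm.trans h
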